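/- Let $n\ge 1$ be an integer and let $\alpha,\beta>-1$ be real. Let $P_n^{(\alpha,\beta)}$ be the Jacobi polynomial of degree $n$. The polynomial $(1-x^2)\,\frac{d}{dx}P_n^{(\alpha,\beta)}(x)$ has exactly $n+1$ distinct real roots $-1=x_0<x_1<\cdots<x_n=1$. Let $$w_j=\int_{-1}^{1}(1-x)^\alpha(1+x)^\beta\,\ell_j(x)\,dx,\qquad \ell_j(x)=\prod_{k\ne j}\frac{x-x_k}{x_j-x_k},\qquad 0\le j\le n,$$ be the weights of the interpolatory quadrature rule with these nodes for the weight function $(1-x)^\alpha(1+x)^\beta$. Then the barycentric weights $\lambda_j=\prod_{k\ne j}(x_j-x_k)^{-1}$ of the nodes are $$\lambda_j=C_{n-2}^{(\alpha+1,\beta+1)}\,(-1)^j\sqrt{\delta_j w_j},\qquad j=0,\dots,n,\qquad \delta_j=\begin{cases}\beta+1,& j=0,\\ \alpha+1,& j=n,\\ 1,&\text{otherwise,}\end{cases}$$ where, for integers $m\ge -1$ and real $a,b>0$, $$C_m^{(a,b)}=(-1)^m\,\frac{\Gamma(2m+a+b+3)}{2^{\,m+1+\frac{a+b+1}{2}}}\,\frac{1}{\sqrt{(m+1)!\,\Gamma(m+a+b+2)\,\Gamma(m+a+2)\,\Gamma(m+b+2)}}.$$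 Moreover, the numbers $(-1)^j\sqrt{\delta_j w_j}$ obtained by deleting the factor $C_{n-2}^{(\alpha+1,\beta+1)}$ are simplified barycentric weights, i.e. there is one nonzero constant $c$ with $\lambda_j=c\,(-1)^j\sqrt{\delta_j w_j}$ for all $j$. -/

import Mathlib

open Polynomial

noncomputable section

/-- The Jacobi polynomial `P_n^{(α,β)}`, in Szegő's explicit form, valid for all real `α, β`:
`∑_{k=0}^n (1/n!) (n choose k) (n+α+β+1)(n+α+β+2)⋯(n+α+β+k) (α+k+1)(α+k+2)⋯(α+n) ((x-1)/2)^k`.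
Here `(ascPochhammer ℝ k).eval a = a (a+1) ⋯ (a+k-1)`. -/
def jacobiPoly (n : ℕ) (α β : ℝ) : ℝ[X] :=
  ∑ k ∈ Finset.range (n + 1),
    C ((n.choose k : ℝ) / (n.factorial : ℝ)
        * (ascPochhammer ℝ k).eval ((n : ℝ) + α + β + 1)
        * (ascPochhammer ℝ (n - k)).eval (α + (k : ℝ) + 1))
      * (C (1 / 2 : ℝ) * (X - 1)) ^ k

/-- `-1 = x_0 < x_1 < ⋯ < x_n = 1` is the list of all roots of
`(1 - X²) (P_n^{(α,β)})'`. -/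
structure IsJacobiLobattoNodes (n : ℕ) (α β : ℝ) (x : Fin (n + 1) → ℝ) : Prop where
  strictMono : StrictMono x
  first : x 0 = -1
  last : x (Fin.last n) = 1
  isRoot_iff : ∀ t : ℝ,
    ((1 - X ^ 2) * derivative (jacobiPoly n α β) : ℝ[X]).IsRoot t ↔ ∃ j, x j = t

/-- The weights `w_j = ∫_{-1}^1 (1-t)^α (1+t)^β ℓ_j(t) dt` of the interpolatory quadrature rule
with nodes `x_j` for the Jacobi weight function; `ℓ_j` is the `j`-th Lagrange fundamental
polynomial of the nodes. -/
def jacobiQuadWeight {n : ℕ} (α β : ℝ) (x : Fin (n + 1) → ℝ) (j : Fin (n + 1)) : ℝ :=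
  ∫ t in (-1 : ℝ)..1,
    (1 - t) ^ α * (1 + t) ^ β * (Lagrange.basis Finset.univ x j).eval t

/-- The barycentric weights `λ_j = 1 / ∏_{k ≠ j} (x_j - x_k)` of the nodes `x_0, …, x_n`. -/
def barycentricWeight {n : ℕ} (x : Fin (n + 1) → ℝ) (j : Fin (n + 1)) : ℝ :=
  1 / ∏ k ∈ Finset.univ.erase j, (x j - x k)

/-- `μ` is obtained from the barycentric weights by cancelling a common nonzero factor. -/
def IsSimplifiedBarycentricWeights {n : ℕ} (x μ : Fin (n + 1) → ℝ) : Prop :=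
  ∃ c : ℝ, c ≠ 0 ∧ ∀ j, barycentricWeight x j = c * μ j

/-- The constant `C_m^{(α,β)}`. The index is an integer because `m = -1` also occurs;
it is used for `m ≥ -1` only. -/
def jacobiBaryConst (m : ℤ) (α β : ℝ) : ℝ :=
  (if Even m then 1 else -1)
    * (Real.Gamma (2 * (m : ℝ) + α + β + 3)
        / (2 : ℝ) ^ ((m : ℝ) + 1 + (α + β + 1) / 2))
    * (1 / √(((m + 1).toNat.factorial : ℝ) * Real.Gamma ((m : ℝ) + α + β + 2)
        * Real.Gamma ((m : ℝ) + α + 2) * Real.Gamma ((m : ℝ) + β + 2)))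

/-- `δ_0 = β + 1`, `δ_n = α + 1`, and `δ_j = 1` otherwise. -/
def lobattoDelta {n : ℕ} (α β : ℝ) (j : Fin (n + 1)) : ℝ :=
  if j = 0 then β + 1 else if j = Fin.last n then α + 1 else 1

end

/-! Let `L` be integration against the Jacobi weight (`jacobiFunctional`) and `L'` the same with
parameters `α+1`, `β+1`, so that `L' p = L ((1-X²) p)`. Put `m = n-1`, and let `q` be the monic
multiple of the derivative of `P_n`. It solves the Jacobi equation of degree `m` for `α+1`, `β+1`,
and the nodal polynomial is `(X²-1) q`.

Write `G_j` for the nodal polynomial without the factor `X - x_j`. Then `λ_j = 1 / G_j(x_j)` and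
`w_j = λ_j L(G_j)`, hence `δ_j w_j = λ_j² · δ_j G_j(x_j) L(G_j)`. The theorem amounts to `δ_j
G_j(x_j) L(G_j) = K` with `K = (2m+α+β+3) L'(q²)` independent of `j`
(`lobattoDelta_mul_functional_nodal`). The sign of `λ_j` is `(-1)^(n-j)`, so taking the square root
gives the formula with constant `(-1)^n / √K`.

The constancy comes from the Pearson identity (integration by parts) and orthogonality: a suitable
multiple of `G_j` is integrated as `q u` with `deg u ≤ m`, and only the coefficient of `X^m` in `u`
survives. At the endpoints the linear coefficient of the differential equation takes the values
`2(β+1)` and `-2(α+1)`, which is the origin of `δ_j`. The closed form of `K` follows from a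
recursion for `L(y²)` under differentiation. -/

/-! ### Integration against the Jacobi weight -/

theorem intervalIntegrable_jacobiWeight {α β : ℝ} (hα : -1 < α) (hβ : -1 < β) :
    IntervalIntegrable (fun t : ℝ => (1 - t) ^ α * (1 + t) ^ β) MeasureTheory.volume (-1) 1 := by
  -- Splitting at 0 leaves at most one singular factor on each half; the other is continuous there.
  refine IntervalIntegrable.trans (b := 0) ?_ ?_
  · have h : IntervalIntegrable (fun t : ℝ => (1 + t) ^ β) MeasureTheory.volume (-1) 0 := by
      have := (intervalIntegral.intervalIntegrable_rpow' (a := 0) (b := 1) hβ).comp_add_left 1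
      simpa using this
    refine h.continuousOn_mul ?_
    refine ContinuousOn.rpow_const (by fun_prop) fun t ht => Or.inl ?_
    rw [Set.uIcc_of_le (by norm_num)] at ht
    linarith [ht.2]
  · have h : IntervalIntegrable (fun t : ℝ => (1 - t) ^ α) MeasureTheory.volume 0 1 := by
      have := (intervalIntegral.intervalIntegrable_rpow' (a := 1) (b := 0) hα).comp_sub_left 1
      simpa using this
    refine h.mul_continuousOn ?_
    refine ContinuousOn.rpow_const (by fun_prop) fun t ht => Or.inl ?_
    rw [Set.uIcc_of_le (by norm_num)] at ht
    linarith [ht.1]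

theorem intervalIntegrable_jacobiWeight_mul_eval {α β : ℝ} (hα : -1 < α) (hβ : -1 < β)
    (p : ℝ[X]) :
    IntervalIntegrable (fun t : ℝ => (1 - t) ^ α * (1 + t) ^ β * p.eval t)
      MeasureTheory.volume (-1) 1 :=
  (intervalIntegrable_jacobiWeight hα hβ).mul_continuousOn p.continuous.continuousOn

/-- Integration of polynomials against the Jacobi weight on `[-1, 1]`, as a linear functional. -/
noncomputable def jacobiFunctional {α β : ℝ} (hα : -1 < α) (hβ : -1 < β) : ℝ[X] →ₗ[ℝ] ℝ where
  toFun p := ∫ t in (-1 : ℝ)..1, (1 - t) ^ α * (1 + t) ^ β * p.eval t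
  map_add' p q := by
    rw [← intervalIntegral.integral_add (intervalIntegrable_jacobiWeight_mul_eval hα hβ p)
      (intervalIntegrable_jacobiWeight_mul_eval hα hβ q)]
    simp only [eval_add, mul_add]
  map_smul' c p := by
    rw [RingHom.id_apply, smul_eq_mul, ← intervalIntegral.integral_const_mul]
    refine intervalIntegral.integral_congr fun t _ => ?_
    simp only [eval_smul, smul_eq_mul]
    ring

theorem jacobiFunctional_apply {α β : ℝ} (hα : -1 < α) (hβ : -1 < β) (p : ℝ[X]) :
    jacobiFunctional hα hβ p = ∫ t in (-1 : ℝ)..1, (1 - t) ^ α * (1 + t) ^ β * p.eval t := rfl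

theorem jacobiFunctional_C_mul {α β : ℝ} (hα : -1 < α) (hβ : -1 < β) (c : ℝ) (p : ℝ[X]) :
    jacobiFunctional hα hβ (C c * p) = c * jacobiFunctional hα hβ p := by
  rw [← smul_eq_C_mul, map_smul, smul_eq_mul]

/-- The linear coefficient `(β - α) - (α + β + 2) X` of the Jacobi differential equation. -/
noncomputable def jacobiDrift (α β : ℝ) : ℝ[X] := C (β - α) - C (α + β + 2) * X

/-- The integrand is the derivative of `(1-t)^(α+1) (1+t)^(β+1) p(t)`, which vanishes at both
endpoints because the exponents are positive. Every later integration by parts is an instance of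
this. -/
theorem jacobiFunctional_pearson {α β : ℝ} (hα : -1 < α) (hβ : -1 < β) (p : ℝ[X]) :
    jacobiFunctional hα hβ (jacobiDrift α β * p + (1 - X ^ 2) * derivative p) = 0 := by
  rw [jacobiFunctional_apply]
  have hc : ContinuousOn (fun t : ℝ => (1 - t) ^ (α + 1) * (1 + t) ^ (β + 1) * p.eval t)
      (Set.Icc (-1) 1) := by
    refine ContinuousOn.mul (ContinuousOn.mul ?_ ?_) p.continuous.continuousOn
    · exact ContinuousOn.rpow_const (by fun_prop) fun t _ => Or.inr (by linarith)
    · exact ContinuousOn.rpow_const (by fun_prop) fun t _ => Or.inr (by linarith)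
  rw [intervalIntegral.integral_eq_sub_of_hasDerivAt_of_le (by norm_num) hc ?_
    (intervalIntegrable_jacobiWeight_mul_eval hα hβ _)]
  · have h1 : α + 1 ≠ 0 := by linarith
    have h2 : β + 1 ≠ 0 := by linarith
    simp [Real.zero_rpow h1, Real.zero_rpow h2]
  · intro t ht
    have h1 : 0 < 1 - t := by linarith [ht.2]
    have h2 : 0 < 1 + t := by linarith [ht.1]
    have d1 : HasDerivAt (fun t : ℝ => (1 - t) ^ (α + 1)) (-1 * (α + 1) * (1 - t) ^ α) t := by
      have := ((hasDerivAt_id t).const_sub 1).rpow_const (p := α + 1) (Or.inl h1.ne')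
      simpa using this
    have d2 : HasDerivAt (fun t : ℝ => (1 + t) ^ (β + 1)) ((β + 1) * (1 + t) ^ β) t := by
      have := ((hasDerivAt_id t).const_add 1).rpow_const (p := β + 1) (Or.inl h2.ne')
      simpa using this
    convert! (d1.mul d2).mul (p.hasDerivAt t) using 1
    rw [Pi.mul_apply, Real.rpow_add h1, Real.rpow_add h2, Real.rpow_one, Real.rpow_one]
    simp only [jacobiDrift, eval_add, eval_mul, eval_sub, eval_C, eval_X, eval_pow, eval_one]
    ring

theorem jacobiFunctional_succ {α β : ℝ} (hα : -1 < α) (hβ : -1 < β) (hα' : -1 < α + 1)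
    (hβ' : -1 < β + 1) (p : ℝ[X]) :
    jacobiFunctional hα' hβ' p = jacobiFunctional hα hβ ((1 - X ^ 2) * p) := by
  rw [jacobiFunctional_apply, jacobiFunctional_apply]
  refine intervalIntegral.integral_congr_Ioo_of_le (by norm_num) fun t ht => ?_
  have h1 : 0 < 1 - t := by linarith [ht.2]
  have h2 : 0 < 1 + t := by linarith [ht.1]
  simp only [eval_mul, eval_sub, eval_X, eval_pow, eval_one]
  rw [Real.rpow_add h1, Real.rpow_add h2, Real.rpow_one, Real.rpow_one]
  ring

theorem jacobiFunctional_pos {α β : ℝ} (hα : -1 < α) (hβ : -1 < β) {p : ℝ[X]} (hp : p ≠ 0)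
    (hnn : ∀ t ∈ Set.Ioo (-1 : ℝ) 1, 0 ≤ p.eval t) : 0 < jacobiFunctional hα hβ p := by
  rw [jacobiFunctional_apply, intervalIntegral.integral_pos_iff_support_of_nonneg_ae' ?_
    (intervalIntegrable_jacobiWeight_mul_eval hα hβ p)]
  · refine ⟨by norm_num, ?_⟩
    -- Inside the interval the integrand vanishes only at the finitely many roots of `p`, a null
    -- set.
    have hsub : Set.Ioo (-1 : ℝ) 1 \ (p.roots.toFinset : Set ℝ) ⊆
        Function.support (fun t : ℝ => (1 - t) ^ α * (1 + t) ^ β * p.eval t) ∩ Set.Ioc (-1) 1 := by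
      rintro t ⟨ht, hr⟩
      have h1 : 0 < 1 - t := by linarith [ht.2]
      have h2 : 0 < 1 + t := by linarith [ht.1]
      refine ⟨?_, Set.Ioo_subset_Ioc_self ht⟩
      have hpt : p.eval t ≠ 0 := by
        simpa [hp, IsRoot] using hr
      exact mul_ne_zero (mul_pos (Real.rpow_pos_of_pos h1 _) (Real.rpow_pos_of_pos h2 _)).ne' hpt
    refine lt_of_lt_of_le ?_ (MeasureTheory.measure_mono hsub)
    rw [MeasureTheory.measure_sdiff_null ((Finset.finite_toSet _).measure_zero _), Real.volume_Ioo]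
    norm_num
  · rw [Set.uIoc_of_le (by norm_num)]
    refine MeasureTheory.ae_restrict_of_ae_eq_of_ae_restrict MeasureTheory.Ioo_ae_eq_Ioc ?_
    rw [MeasureTheory.ae_restrict_iff' measurableSet_Ioo]
    filter_upwards with t ht
    have h1 : 0 < 1 - t := by linarith [ht.2]
    have h2 : 0 < 1 + t := by linarith [ht.1]
    exact mul_nonneg (mul_pos (Real.rpow_pos_of_pos h1 _) (Real.rpow_pos_of_pos h2 _)).le (hnn t ht)

/-- The substitution `x = t + 1` turns the integral into Euler's Beta integral scaled to `[0, 2]`.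
-/
theorem jacobiFunctional_one {α β : ℝ} (hα : -1 < α) (hβ : -1 < β) :
    jacobiFunctional hα hβ 1 = 2 ^ (α + β + 1) * Real.Gamma (α + 1) * Real.Gamma (β + 1)
      / Real.Gamma (α + β + 2) := by
  have hscaled := Complex.betaIntegral_scaled ((β + 1 : ℝ) : ℂ) ((α + 1 : ℝ) : ℂ) two_pos
  rw [Complex.betaIntegral_eq_Gamma_mul_div _ _ (by simp; linarith) (by simp; linarith)] at hscaled
  have hint : (∫ x in (0 : ℝ)..2, (x : ℂ) ^ (((β + 1 : ℝ) : ℂ) - 1)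
      * (((2 : ℝ) : ℂ) - x) ^ (((α + 1 : ℝ) : ℂ) - 1))
      = ((∫ x in (0 : ℝ)..2, x ^ β * (2 - x) ^ α : ℝ) : ℂ) := by
    rw [← intervalIntegral.integral_ofReal]
    refine intervalIntegral.integral_congr fun x hx => ?_
    rw [Set.uIcc_of_le (by norm_num)] at hx
    have h2 : 0 ≤ 2 - x := by linarith [hx.2]
    have e1 : ((β + 1 : ℝ) : ℂ) - 1 = (β : ℂ) := by push_cast; ring
    have e2 : ((α + 1 : ℝ) : ℂ) - 1 = (α : ℂ) := by push_cast; ring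
    simp only [e1, e2]
    rw [Complex.ofReal_mul, Complex.ofReal_cpow hx.1, Complex.ofReal_cpow h2]
    push_cast
    rfl
  rw [hint, ← Complex.ofReal_add, Complex.Gamma_ofReal, Complex.Gamma_ofReal, Complex.Gamma_ofReal,
    show (((β + 1 + (α + 1) : ℝ) : ℂ) - 1) = ((α + β + 1 : ℝ) : ℂ) by push_cast; ring,
    ← Complex.ofReal_cpow two_pos.le] at hscaled
  have hreal : (∫ x in (0 : ℝ)..2, x ^ β * (2 - x) ^ α) = 2 ^ (α + β + 1)
      * (Real.Gamma (β + 1) * Real.Gamma (α + 1) / Real.Gamma (β + 1 + (α + 1))) := by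
    exact_mod_cast hscaled
  have hshift := intervalIntegral.integral_comp_add_right (a := -1) (b := 1)
    (fun x : ℝ => x ^ β * (2 - x) ^ α) 1
  rw [jacobiFunctional_apply]
  norm_num at hshift
  rw [hreal] at hshift
  rw [show α + β + 2 = β + 1 + (α + 1) by ring]
  calc _ = ∫ x in (-1 : ℝ)..1, (x + 1) ^ β * (2 - (x + 1)) ^ α := by
        refine intervalIntegral.integral_congr fun x _ => ?_
        simp only [eval_one, mul_one]
        rw [mul_comm, add_comm 1 x, show 2 - (x + 1) = 1 - x by ring]
    _ = _ := by rw [hshift]; ring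

/-! ### The Jacobi differential equation and orthogonality -/

/-- `y` satisfies the Jacobi differential equation
`(1 - X²) y'' + (β - α - (α + β + 2) X) y' + n (n + α + β + 1) y = 0`. -/
def IsJacobiSolution (n : ℕ) (α β : ℝ) (y : ℝ[X]) : Prop :=
  (1 - X ^ 2) * derivative (derivative y) + jacobiDrift α β * derivative y
    + C ((n : ℝ) * (n + α + β + 1)) * y = 0

theorem IsJacobiSolution.C_mul {n : ℕ} {α β : ℝ} {y : ℝ[X]} (h : IsJacobiSolution n α β y)
    (c : ℝ) : IsJacobiSolution n α β (C c * y) := by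
  unfold IsJacobiSolution at *
  simp only [derivative_C_mul]
  linear_combination C c * h

theorem IsJacobiSolution.derivative {n : ℕ} {α β : ℝ} {y : ℝ[X]}
    (h : IsJacobiSolution (n + 1) α β y) :
    IsJacobiSolution n (α + 1) (β + 1) (derivative y) := by
  unfold IsJacobiSolution jacobiDrift at *
  have h' := congrArg Polynomial.derivative h
  simp only [derivative_add, derivative_mul, derivative_sub, derivative_one, derivative_X_pow,
    derivative_C, derivative_X, derivative_zero] at h'
  push_cast at h'
  simp only [map_add, map_sub, map_mul, map_one, map_natCast, map_ofNat] at h' ⊢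
  linear_combination h'

/-- The polynomial in `u` whose value at `u = (x - 1) / 2` is `P_n^{(α,β)}(x)`. -/
noncomputable def jacobiShifted (n : ℕ) (α β : ℝ) : ℝ[X] :=
  ∑ k ∈ Finset.range (n + 1),
    C ((n.choose k : ℝ) / (n.factorial : ℝ)
        * (ascPochhammer ℝ k).eval ((n : ℝ) + α + β + 1)
        * (ascPochhammer ℝ (n - k)).eval (α + (k : ℝ) + 1)) * X ^ k

theorem jacobiShifted_comp (n : ℕ) (α β : ℝ) :
    (jacobiShifted n α β).comp (C (1 / 2 : ℝ) * (X - 1)) = jacobiPoly n α β := by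
  unfold jacobiShifted jacobiPoly
  rw [Polynomial.sum_comp]
  refine Finset.sum_congr rfl fun k _ => ?_
  rw [C_mul_comp, X_pow_comp]

theorem coeff_jacobiShifted (n : ℕ) (α β : ℝ) (k : ℕ) :
    (jacobiShifted n α β).coeff k = (n.choose k : ℝ) / (n.factorial : ℝ)
        * (ascPochhammer ℝ k).eval ((n : ℝ) + α + β + 1)
        * (ascPochhammer ℝ (n - k)).eval (α + (k : ℝ) + 1) := by
  unfold jacobiShifted
  rw [finsetSum_coeff]
  simp only [coeff_C_mul_X_pow]
  rw [Finset.sum_ite_eq]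
  split_ifs with h
  · rfl
  · rw [Finset.mem_range] at h
    rw [Nat.choose_eq_zero_of_lt (by omega)]
    simp

/-- The hypergeometric two-term recurrence, which is the differential equation in the variable `u`
read coefficientwise. -/
theorem coeff_jacobiShifted_succ (n : ℕ) (α β : ℝ) (k : ℕ) :
    (jacobiShifted n α β).coeff (k + 1) * (k + 1) * (k + α + 1)
      = (jacobiShifted n α β).coeff k * (n - k) * (n + k + α + β + 1) := by
  rw [coeff_jacobiShifted, coeff_jacobiShifted]
  rcases lt_or_ge k n with hk | hk
  · obtain ⟨d, rfl⟩ := Nat.exists_eq_add_of_lt hk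
    have hch := Nat.choose_succ_right_eq (k + d + 1) k
    rw [show k + d + 1 - k = d + 1 by omega] at hch ⊢
    rw [show k + d + 1 - (k + 1) = d by omega, ascPochhammer_succ_eval, ascPochhammer_succ_left]
    have hch' : ((k + d + 1).choose (k + 1) : ℝ) * (k + 1)
        = (k + d + 1).choose k * (d + 1) := by exact_mod_cast hch
    simp only [eval_mul, eval_X, eval_comp, eval_add, eval_one]
    push_cast
    rw [show α + ((k : ℝ) + 1) + 1 = α + k + 1 + 1 by ring]
    linear_combination (1 / ((k + d + 1).factorial : ℝ)
      * (eval (k + d + 1 + α + β + 1 : ℝ) (ascPochhammer ℝ k) * (k + d + 1 + α + β + 1 + k))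
      * eval (α + k + 1 + 1) (ascPochhammer ℝ d) * (k + α + 1)) * hch'
  · rw [Nat.choose_eq_zero_of_lt (show n < k + 1 by omega)]
    rcases hk.eq_or_lt with rfl | hk
    · simp
    · rw [Nat.choose_eq_zero_of_lt hk]
      simp

theorem jacobiShifted_ode (n : ℕ) (α β : ℝ) :
    X * (1 + X) * derivative (derivative (jacobiShifted n α β))
      + (C (α + 1) + C (α + β + 2) * X) * derivative (jacobiShifted n α β)
      = C ((n : ℝ) * (n + α + β + 1)) * jacobiShifted n α β := by
  have hrec := coeff_jacobiShifted_succ n α β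
  set Q := jacobiShifted n α β
  -- Each power of `X` is moved to the front, where `coeff_X_mul` applies.
  rw [show X * (1 + X) * derivative (derivative Q)
      + (C (α + 1) + C (α + β + 2) * X) * derivative Q
      = X * derivative (derivative Q) + X * (X * derivative (derivative Q))
        + (C (α + 1) * derivative Q + C (α + β + 2) * (X * derivative Q)) by ring]
  ext k
  have hk := hrec k
  rcases k with _ | _ | k <;>
  · simp only [coeff_add, coeff_C_mul, coeff_X_mul, coeff_X_mul_zero, coeff_derivative, zero_add]
    try simp only [zero_add] at hk
    push_cast at hk ⊢
    linear_combination hk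

theorem isJacobiSolution_jacobiPoly (n : ℕ) (α β : ℝ) :
    IsJacobiSolution n α β (jacobiPoly n α β) := by
  have hode := congrArg (fun p => p.comp (C (1 / 2 : ℝ) * (X - 1))) (jacobiShifted_ode n α β)
  unfold IsJacobiSolution jacobiDrift
  rw [← jacobiShifted_comp]
  simp only [derivative_comp, derivative_mul, derivative_C, derivative_sub, derivative_X,
    derivative_one, zero_mul, zero_add, sub_zero, mul_one]
  simp only [add_comp, mul_comp, X_comp, one_comp, C_comp] at hode
  -- `C (1 / 2)` is an atom for `ring`; this relation is all that is needed about it.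
  have h2 : (C (1 / 2) * 2 : ℝ[X]) = 1 := by
    rw [show (2 : ℝ[X]) = C 2 from rfl, ← C_mul]; norm_num
  set A := (derivative (derivative (jacobiShifted n α β))).comp (C (1 / 2 : ℝ) * (X - 1))
  set B := (derivative (jacobiShifted n α β)).comp (C (1 / 2 : ℝ) * (X - 1))
  set D := (jacobiShifted n α β).comp (C (1 / 2 : ℝ) * (X - 1))
  simp only [map_add, map_sub, map_mul, map_one, map_natCast, map_ofNat] at hode ⊢
  set h : ℝ[X] := C (1 / 2)
  linear_combination -hode - h * (X - 1) * A * h2 - (C α + 1) * B * h2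

theorem natDegree_jacobiShifted_le (n : ℕ) (α β : ℝ) : (jacobiShifted n α β).natDegree ≤ n := by
  rw [natDegree_le_iff_coeff_eq_zero]
  intro k hk
  rw [coeff_jacobiShifted, Nat.choose_eq_zero_of_lt hk]
  simp

theorem natDegree_jacobiPoly {n : ℕ} (hn : 1 ≤ n) {α β : ℝ} (hα : -1 < α) (hβ : -1 < β) :
    (jacobiPoly n α β).natDegree = n := by
  have hn' : (1 : ℝ) ≤ n := by exact_mod_cast hn
  have hcoeff : (jacobiShifted n α β).coeff n ≠ 0 := by
    rw [coeff_jacobiShifted, Nat.sub_self, ascPochhammer_zero, eval_one, mul_one, Nat.choose_self]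
    have := ascPochhammer_pos n ((n : ℝ) + α + β + 1) (by linarith)
    positivity
  rw [← jacobiShifted_comp, natDegree_comp,
    le_antisymm (natDegree_jacobiShifted_le n α β) (le_natDegree_of_ne_zero hcoeff),
    natDegree_C_mul (by norm_num), ← C_1, natDegree_X_sub_C, mul_one]

theorem IsJacobiSolution.orthogonal_X_pow {n : ℕ} {α β : ℝ} (hα : -1 < α) (hβ : -1 < β) {y : ℝ[X]}
    (h : IsJacobiSolution n α β y) (k : ℕ) (hk : k < n) :
    jacobiFunctional hα hβ (y * X ^ k) = 0 := by
  -- the operator `T p = (1 - X²) p'' + (β - α - (α + β + 2) X) p'` is symmetric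
  have hsym : ∀ p : ℝ[X], jacobiFunctional hα hβ (y * ((1 - X ^ 2) * Polynomial.derivative
      (Polynomial.derivative p) + jacobiDrift α β * Polynomial.derivative p
      + C ((n : ℝ) * (n + α + β + 1)) * p)) = 0 := by
    intro p
    have hP := jacobiFunctional_pearson hα hβ
      (y * Polynomial.derivative p - p * Polynomial.derivative y)
    rw [← hP]
    congr 1
    simp only [derivative_sub, derivative_mul]
    unfold IsJacobiSolution at h
    linear_combination (p : ℝ[X]) * h
  induction k using Nat.strong_induction_on with
  | _ k ih =>
    have hkn : (k : ℝ) + 1 ≤ n := by exact_mod_cast hk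
    -- This is the difference of the eigenvalues of `T` in degrees `k` and `n`. It multiplies `y * X
    -- ^ k` in `hsym (X ^ k)`, whose other terms involve lower powers and vanish by induction.
    have hpos : ((n : ℝ) - k) * (n + k + α + β + 1) ≠ 0 := by
      have : (0 : ℝ) ≤ k := k.cast_nonneg
      exact (mul_pos (by linarith) (by linarith)).ne'
    have hs := hsym (X ^ k)
    rcases k with _ | _ | k
    · rw [show y * ((1 - X ^ 2) * Polynomial.derivative (Polynomial.derivative (X ^ 0 : ℝ[X]))
          + jacobiDrift α β * Polynomial.derivative (X ^ 0 : ℝ[X])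
          + C ((n : ℝ) * (n + α + β + 1)) * X ^ 0)
          = C ((n : ℝ) * (n + α + β + 1)) * (y * X ^ 0) by simp; ring,
        jacobiFunctional_C_mul] at hs
      refine (mul_eq_zero.mp hs).resolve_left fun h0 => hpos ?_
      rw [← h0]
      push_cast
      ring
    · rw [show y * ((1 - X ^ 2) * Polynomial.derivative (Polynomial.derivative (X ^ (0 + 1) : ℝ[X]))
          + jacobiDrift α β * Polynomial.derivative (X ^ (0 + 1) : ℝ[X])
          + C ((n : ℝ) * (n + α + β + 1)) * X ^ (0 + 1))
          = C ((n - 1 : ℝ) * (n + 1 + α + β + 1)) * (y * X ^ (0 + 1))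
            + C (β - α) * (y * X ^ 0) by
          unfold jacobiDrift
          simp only [zero_add, pow_one, derivative_X, derivative_one, pow_zero, map_add, map_sub,
            map_mul, map_one, map_ofNat]
          ring,
        map_add, jacobiFunctional_C_mul, jacobiFunctional_C_mul,
        ih 0 (by omega) (by omega), mul_zero, add_zero] at hs
      refine (mul_eq_zero.mp hs).resolve_left fun h0 => hpos ?_
      rw [← h0]
      push_cast
      ring
    · rw [show y * ((1 - X ^ 2) * Polynomial.derivative (Polynomial.derivative (X ^ (k + 2) : ℝ[X]))
          + jacobiDrift α β * Polynomial.derivative (X ^ (k + 2) : ℝ[X])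
          + C ((n : ℝ) * (n + α + β + 1)) * X ^ (k + 2))
          = C (((n : ℝ) - (k + 2)) * (n + (k + 2) + α + β + 1)) * (y * X ^ (k + 2))
            + C ((k + 2) * (β - α)) * (y * X ^ (k + 1))
            + C (((k : ℝ) + 2) * (k + 1)) * (y * X ^ k) by
          unfold jacobiDrift
          simp only [derivative_X_pow, derivative_mul, derivative_natCast,
            derivative_ofNat,
            Nat.add_sub_cancel, show k + 2 - 1 = k + 1 from rfl, map_add, map_sub,
            map_mul, map_one, map_ofNat, map_natCast, Nat.cast_add, Nat.cast_ofNat, Nat.cast_one]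
          ring,
        map_add, map_add, jacobiFunctional_C_mul, jacobiFunctional_C_mul, jacobiFunctional_C_mul,
        ih (k + 1) (by omega) (by omega), ih k (by omega) (by omega),
        mul_zero, add_zero, mul_zero, add_zero] at hs
      refine (mul_eq_zero.mp hs).resolve_left fun h0 => hpos ?_
      rw [← h0]
      push_cast
      ring

theorem IsJacobiSolution.orthogonal {n : ℕ} {α β : ℝ} (hα : -1 < α) (hβ : -1 < β) {y : ℝ[X]}
    (h : IsJacobiSolution n α β y) {p : ℝ[X]} (hp : p.degree < n) :
    jacobiFunctional hα hβ (y * p) = 0 := by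
  rw [p.as_sum_range_C_mul_X_pow, Finset.mul_sum, map_sum]
  refine Finset.sum_eq_zero fun k hk => ?_
  rw [mul_left_comm, jacobiFunctional_C_mul]
  rcases lt_or_ge k n with hkn | hkn
  · rw [h.orthogonal_X_pow hα hβ k hkn, mul_zero]
  · rw [coeff_eq_zero_of_degree_lt (hp.trans_le (by exact_mod_cast hkn)), zero_mul]

/-- Subtracting `p.coeff n` times `y` from `p` lowers the degree below `n`, where orthogonality
applies. -/
theorem IsJacobiSolution.functional_mul {n : ℕ} {α β : ℝ} (hα : -1 < α) (hβ : -1 < β) {y : ℝ[X]}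
    (h : IsJacobiSolution n α β y) (hy : y.Monic) (hdeg : y.natDegree = n) {p : ℝ[X]}
    (hp : p.natDegree ≤ n) :
    jacobiFunctional hα hβ (y * p) = p.coeff n * jacobiFunctional hα hβ (y * y) := by
  have hlt : (p - C (p.coeff n) * y).degree < n := by
    rw [degree_lt_iff_coeff_zero]
    intro k hk
    rcases hk.eq_or_lt with rfl | hk
    · have : y.coeff n = 1 := by rw [← hdeg]; exact hy
      simp [this]
    · rw [coeff_sub, coeff_C_mul, coeff_eq_zero_of_natDegree_lt (hp.trans_lt hk),
        coeff_eq_zero_of_natDegree_lt (hdeg.trans_lt hk)]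
      simp
  have := h.orthogonal hα hβ hlt
  rw [mul_sub, map_sub, mul_left_comm, jacobiFunctional_C_mul] at this
  linarith

/-! ### The norm of the monic Jacobi polynomial -/

/-- The Pearson identity for `y' y`, with the differential equation used to eliminate `y''`. -/
theorem IsJacobiSolution.functional_derivative_sq {n : ℕ} {α β : ℝ} (hα : -1 < α) (hβ : -1 < β)
    (hα' : -1 < α + 1) (hβ' : -1 < β + 1) {y : ℝ[X]} (h : IsJacobiSolution n α β y) :
    jacobiFunctional hα' hβ' (Polynomial.derivative y * Polynomial.derivative y)
      = n * (n + α + β + 1) * jacobiFunctional hα hβ (y * y) := by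
  rw [jacobiFunctional_succ hα hβ, ← jacobiFunctional_C_mul]
  have hP := jacobiFunctional_pearson hα hβ (Polynomial.derivative y * y)
  rw [← sub_eq_zero, ← map_sub, ← hP]
  congr 1
  simp only [derivative_mul]
  unfold IsJacobiSolution at h
  linear_combination (-y) * h

/-- Induction on the degree: `y' / (n+1)` is monic of degree `n` and solves the equation for `α+1`,
`β+1`. The condition `-1 < α + β` keeps `Γ(α+β+1)` positive, so that it cancels in degree 0. -/
theorem IsJacobiSolution.functional_sq (n : ℕ) : ∀ {α β : ℝ} (hα : -1 < α) (hβ : -1 < β),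
    -1 < α + β → ∀ {y : ℝ[X]}, IsJacobiSolution n α β y → y.Monic → y.natDegree = n →
    jacobiFunctional hα hβ (y * y) = 2 ^ (2 * n + α + β + 1) * (n.factorial : ℝ)
      * Real.Gamma (n + α + 1) * Real.Gamma (n + β + 1) * Real.Gamma (n + α + β + 1)
      / (Real.Gamma (2 * n + α + β + 1) * Real.Gamma (2 * n + α + β + 2)) := by
  induction n with
  | zero =>
    intro α β hα hβ hαβ y h hy hdeg
    have hy1 : y = 1 := hy.natDegree_eq_zero.mp hdeg
    have := (Real.Gamma_pos_of_pos (show 0 < α + β + 1 by linarith)).ne'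
    rw [hy1, mul_one, jacobiFunctional_one]
    simp only [CharP.cast_eq_zero, mul_zero, zero_add, Nat.factorial_zero, Nat.cast_one, mul_one]
    field_simp
  | succ n ih =>
    intro α β hα hβ hαβ y h hy hdeg
    have hα' : -1 < α + 1 := by linarith
    have hβ' : -1 < β + 1 := by linarith
    have hn0 : (0 : ℝ) ≤ n := n.cast_nonneg
    have hn1 : ((n : ℝ) + 1) ≠ 0 := by positivity
    have hs := h.functional_derivative_sq hα hβ hα' hβ'
    have hcoeff : (Polynomial.derivative y).coeff n = n + 1 := by
      have : y.coeff (n + 1) = 1 := by rw [← hdeg]; exact hy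
      rw [coeff_derivative, this, one_mul]
    have hdeg' : (Polynomial.derivative y).natDegree = n := by
      rw [natDegree_derivative, hdeg, Nat.add_sub_cancel]
    set z := C ((n + 1 : ℝ)⁻¹) * Polynomial.derivative y with hz
    have hzm : z.Monic := by
      rw [Monic, leadingCoeff, hz, natDegree_C_mul (inv_ne_zero hn1), hdeg', coeff_C_mul, hcoeff,
        inv_mul_cancel₀ hn1]
    have hzd : z.natDegree = n := by rw [hz, natDegree_C_mul (inv_ne_zero hn1), hdeg']
    have hi := ih hα' hβ' (by linarith) (h.derivative.C_mul _) hzm hzd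
    rw [show z * z = C ((n + 1 : ℝ)⁻¹ * (n + 1 : ℝ)⁻¹) * (Polynomial.derivative y
      * Polynomial.derivative y) by rw [hz, Polynomial.C_mul]; ring, jacobiFunctional_C_mul, hs] at hi
    have hne : (n : ℝ) + 1 + α + β + 1 ≠ 0 := by linarith
    rw [show (n : ℝ) + (α + 1) + (β + 1) + 1 = n + 1 + α + β + 1 + 1 by ring,
      Real.Gamma_add_one hne, show 2 * (n : ℝ) + (α + 1) + (β + 1) + 1
      = 2 * (n + 1) + α + β + 1 by ring, show 2 * (n : ℝ) + (α + 1) + (β + 1) + 2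
      = 2 * (n + 1) + α + β + 2 by ring, show (n : ℝ) + (α + 1) + 1 = n + 1 + α + 1 by ring,
      show (n : ℝ) + (β + 1) + 1 = n + 1 + β + 1 by ring] at hi
    rw [Nat.factorial_succ]
    push_cast at hi ⊢
    have g1 := (Real.Gamma_pos_of_pos (show 0 < 2 * ((n : ℝ) + 1) + α + β + 1 by linarith)).ne'
    have g2 := (Real.Gamma_pos_of_pos (show 0 < 2 * ((n : ℝ) + 1) + α + β + 2 by linarith)).ne'
    field_simp at hi ⊢
    linear_combination hi

/-! ### Zeros in the open interval and the nodes -/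

/-- `S` collects the zeros of odd multiplicity: each factor `X - r` split off toggles the membership
of `r`, and a polynomial without zeros in the interval has constant sign there. -/
theorem exists_finset_roots_sign_const {f : ℝ[X]} (hf : f ≠ 0) :
    ∃ S : Finset ℝ, (∀ s ∈ S, s ∈ Set.Ioo (-1 : ℝ) 1 ∧ f.IsRoot s) ∧
      ((∀ t ∈ Set.Ioo (-1 : ℝ) 1, 0 ≤ (f * ∏ s ∈ S, (X - C s)).eval t) ∨
        ∀ t ∈ Set.Ioo (-1 : ℝ) 1, (f * ∏ s ∈ S, (X - C s)).eval t ≤ 0) := by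
  induction hd : f.natDegree using Nat.strong_induction_on generalizing f with
  | _ d ih =>
    by_cases hroot : ∃ r ∈ Set.Ioo (-1 : ℝ) 1, f.IsRoot r
    · obtain ⟨r, hr, hfr⟩ := hroot
      obtain ⟨g, rfl⟩ := dvd_iff_isRoot.mpr hfr
      have hg : g ≠ 0 := right_ne_zero_of_mul hf
      have hdeg : g.natDegree < d := by
        rw [← hd, natDegree_mul (X_sub_C_ne_zero r) hg, natDegree_X_sub_C]
        omega
      obtain ⟨S, hS, hsign⟩ := ih _ hdeg hg rfl
      by_cases hrS : r ∈ S
      · refine ⟨S.erase r, fun s hs => ?_, ?_⟩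
        · have := hS s (Finset.mem_of_mem_erase hs)
          exact ⟨this.1, root_mul_left_of_isRoot _ this.2⟩
        · rwa [mul_comm (X - C r) g, mul_assoc,
            Finset.mul_prod_erase S (fun s => X - C s) hrS]
      · refine ⟨insert r S, fun s hs => ?_, ?_⟩
        · rcases Finset.mem_insert.mp hs with rfl | hs
          · exact ⟨hr, hfr⟩
          · exact ⟨(hS s hs).1, root_mul_left_of_isRoot _ (hS s hs).2⟩
        · have hev : ∀ t, ((X - C r) * g * ∏ s ∈ insert r S, (X - C s)).eval t
              = (t - r) ^ 2 * (g * ∏ s ∈ S, (X - C s)).eval t := by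
            intro t
            rw [Finset.prod_insert hrS]
            simp only [eval_mul, eval_sub, eval_X, eval_C]
            ring
          simp only [hev]
          exact hsign.imp (fun h t ht => mul_nonneg (sq_nonneg _) (h t ht))
            (fun h t ht => mul_nonpos_of_nonneg_of_nonpos (sq_nonneg _) (h t ht))
    · push Not at hroot
      refine ⟨∅, by simp, ?_⟩
      rw [Finset.prod_empty, mul_one]
      by_contra! hcon
      obtain ⟨⟨t₁, h₁, hn⟩, t₂, h₂, hp⟩ := hcon
      obtain ⟨r, hr, hr0⟩ := isPreconnected_Ioo.intermediate_value h₁ h₂ f.continuous.continuousOn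
        ⟨hn.le, hp.le⟩
      exact hroot r hr hr0

/-- With fewer than `m` sign changes, `y` would be orthogonal to the product over `S`, although `y`
times this product is nonzero of constant sign. -/
theorem IsJacobiSolution.exists_finset_roots {m : ℕ} {α β : ℝ} (hα : -1 < α) (hβ : -1 < β)
    {y : ℝ[X]} (h : IsJacobiSolution m α β y) (hy : y ≠ 0) (hdeg : y.natDegree = m) :
    ∃ S : Finset ℝ, S.card = m ∧ (∀ t, y.IsRoot t ↔ t ∈ S) ∧ ∀ s ∈ S, s ∈ Set.Ioo (-1 : ℝ) 1 := by
  obtain ⟨S, hS, hsign⟩ := exists_finset_roots_sign_const hy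
  have hsub : S ⊆ y.roots.toFinset := fun s hs => by
    rw [Multiset.mem_toFinset, mem_roots hy]
    exact (hS s hs).2
  have hroots : y.roots.toFinset.card ≤ m :=
    (Multiset.toFinset_card_le _).trans (hdeg ▸ card_roots' y)
  have hmon : (∏ s ∈ S, (X - C s) : ℝ[X]).Monic := monic_prod_X_sub_C _ _
  have hcard : m ≤ S.card := by
    by_contra! hlt
    have hlt' : (∏ s ∈ S, (X - C s) : ℝ[X]).degree < m := by
      rw [degree_eq_natDegree hmon.ne_zero, natDegree_prod_of_monic _ _ fun s _ => monic_X_sub_C s]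
      simpa using hlt
    have hzero := h.orthogonal hα hβ hlt'
    have hne := mul_ne_zero hy hmon.ne_zero
    rcases hsign with hs | hs
    · exact (jacobiFunctional_pos hα hβ hne hs).ne' hzero
    · have := jacobiFunctional_pos hα hβ (neg_ne_zero.mpr hne)
        (fun t ht => by rw [eval_neg]; linarith [hs t ht])
      rw [map_neg, hzero, neg_zero] at this
      exact this.false
  have heq : S = y.roots.toFinset := Finset.eq_of_subset_of_card_le hsub (hroots.trans hcard)
  refine ⟨S, le_antisymm ?_ hcard, fun t => ?_, fun s hs => (hS s hs).1⟩
  · exact heq ▸ hroots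
  · rw [heq, Multiset.mem_toFinset, mem_roots hy]

theorem exists_monic_jacobiPoly_derivative (m : ℕ) {α β : ℝ} (hα : -1 < α) (hβ : -1 < β) :
    ∃ q : ℝ[X], IsJacobiSolution m (α + 1) (β + 1) q ∧ q.Monic ∧ q.natDegree = m ∧
      ∃ c : ℝ, c ≠ 0 ∧ derivative (jacobiPoly (m + 1) α β) = C c * q := by
  have hdeg : (derivative (jacobiPoly (m + 1) α β)).natDegree = m := by
    rw [natDegree_derivative, natDegree_jacobiPoly (by omega) hα hβ, Nat.add_sub_cancel]
  have hne : derivative (jacobiPoly (m + 1) α β) ≠ 0 := by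
    intro h0
    have := Polynomial.derivative_eq_zero.mp h0
    rw [natDegree_jacobiPoly (by omega) hα hβ] at this
    omega
  have hlc := leadingCoeff_ne_zero.mpr hne
  refine ⟨C (derivative (jacobiPoly (m + 1) α β)).leadingCoeff⁻¹
      * derivative (jacobiPoly (m + 1) α β),
    (isJacobiSolution_jacobiPoly _ _ _).derivative.C_mul _, ?_, ?_, _, hlc, ?_⟩
  · rw [Monic, leadingCoeff_mul, leadingCoeff_C, inv_mul_cancel₀ hlc]
  · rw [natDegree_C_mul (inv_ne_zero hlc), hdeg]
  · rw [← mul_assoc, ← C_mul, mul_inv_cancel₀ hlc, C_1, one_mul]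

theorem exists_isJacobiLobattoNodes {n : ℕ} (hn : 1 ≤ n) {α β : ℝ} (hα : -1 < α) (hβ : -1 < β) :
    ∃ x : Fin (n + 1) → ℝ, IsJacobiLobattoNodes n α β x := by
  obtain ⟨m, rfl⟩ := Nat.exists_eq_add_of_le' hn
  obtain ⟨q, hq, hmon, hdeg, c, hc, hder⟩ := exists_monic_jacobiPoly_derivative m hα hβ
  obtain ⟨S, hcard, hroot, hS⟩ := hq.exists_finset_roots (by linarith) (by linarith)
    hmon.ne_zero hdeg
  have h1 : (1 : ℝ) ∉ S := fun h => (hS 1 h).2.false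
  have h2 : (-1 : ℝ) ∉ insert 1 S := by
    rw [Finset.mem_insert, not_or]
    exact ⟨by norm_num, fun h => (hS _ h).1.false⟩
  have hT : (insert (-1) (insert 1 S)).card = m + 1 + 1 := by
    rw [Finset.card_insert_of_notMem h2, Finset.card_insert_of_notMem h1, hcard]
  set T := insert (-1) (insert 1 S) with hTdef
  have hmem : ∀ t, t ∈ T ↔ ∃ j, T.orderEmbOfFin hT j = t := by
    intro t
    rw [← Finset.mem_coe, ← Finset.range_orderEmbOfFin T hT, Set.mem_range]
  have hbound : ∀ j, -1 ≤ T.orderEmbOfFin hT j ∧ T.orderEmbOfFin hT j ≤ 1 := by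
    intro j
    have := T.orderEmbOfFin_mem hT j
    simp only [hTdef, Finset.mem_insert] at this
    rcases this with h | h | h
    · rw [h]; norm_num
    · rw [h]; norm_num
    · exact ⟨(hS _ h).1.le, (hS _ h).2.le⟩
  refine ⟨T.orderEmbOfFin hT, (T.orderEmbOfFin hT).strictMono, ?_, ?_, fun t => ?_⟩
  · obtain ⟨j, hj⟩ := (hmem (-1)).mp (by simp [hTdef])
    refine le_antisymm ?_ (hbound 0).1
    rw [← hj]
    exact (T.orderEmbOfFin hT).monotone (Fin.zero_le j)
  · obtain ⟨j, hj⟩ := (hmem 1).mp (by simp [hTdef])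
    refine le_antisymm (hbound _).2 ?_
    conv_lhs => rw [← hj]
    exact (T.orderEmbOfFin hT).monotone (Fin.le_last j)
  · rw [← hmem, hder, IsRoot, eval_mul, eval_mul, eval_C, mul_eq_zero, mul_eq_zero_iff_left hc,
      show q.eval t = 0 ↔ t ∈ S from hroot t, hTdef, Finset.mem_insert, Finset.mem_insert, ← or_assoc]
    refine or_congr_left ?_
    rw [show ((1 - X ^ 2 : ℝ[X]).eval t = 0) ↔ (t + 1) * (t - 1) = 0 by
      simp only [eval_sub, eval_one, eval_pow, eval_X]
      constructor <;> intro h <;> linear_combination -h, mul_eq_zero]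
    exact or_congr eq_neg_iff_add_eq_zero.symm sub_eq_zero

/-- Both sides are monic of degree `m + 2`, and the left divides the right because the nodes are
distinct roots of it. -/
theorem IsJacobiLobattoNodes.nodal_eq {m : ℕ} {α β : ℝ} {x : Fin (m + 1 + 1) → ℝ}
    (hx : IsJacobiLobattoNodes (m + 1) α β x) {q : ℝ[X]} (hq : q.Monic) (hdeg : q.natDegree = m)
    {c : ℝ} (hc : c ≠ 0) (hder : derivative (jacobiPoly (m + 1) α β) = C c * q) :
    Lagrange.nodal Finset.univ x = (X ^ 2 - 1) * q := by
  have h2 : (X ^ 2 - 1 : ℝ[X]).Monic := by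
    rw [← C_1]; exact monic_X_pow_sub_C 1 two_ne_zero
  refine (eq_of_monic_of_dvd_of_natDegree_le Lagrange.nodal_monic (h2.mul hq) ?_ ?_).symm
  · rw [Lagrange.nodal_eq]
    refine Finset.prod_dvd_of_coprime
      (fun i _ j _ hij => pairwise_coprime_X_sub_C hx.strictMono.injective hij) fun j _ => ?_
    rw [dvd_iff_isRoot]
    have := (hx.isRoot_iff (x j)).mpr ⟨j, rfl⟩
    rw [hder, IsRoot, eval_mul, eval_mul, eval_C] at this
    rw [IsRoot, eval_mul]
    have h3 : (X ^ 2 - 1 : ℝ[X]).eval (x j) = -(1 - X ^ 2 : ℝ[X]).eval (x j) := by simp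
    rw [h3]
    exact mul_left_cancel₀ hc (by linear_combination -this)
  · rw [Lagrange.natDegree_nodal, h2.natDegree_mul hq, hdeg, ← C_1, natDegree_X_pow_sub_C]
    simp
    omega

/-! ### The constant `K` at interior nodes and at the endpoints -/

theorem coeff_X_mul_derivative (p : ℝ[X]) (k : ℕ) :
    (X * derivative p).coeff k = k * p.coeff k := by
  rcases k with _ | k
  · simp
  · rw [coeff_X_mul, coeff_derivative]
    push_cast
    ring

/-- For a zero `r` of `q`, with `q = (X - r) g`. -/
theorem IsJacobiSolution.functional_div_root {m : ℕ} {α β : ℝ} (hα : -1 < α) (hβ : -1 < β)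
    {q : ℝ[X]} (h : IsJacobiSolution m α β q) (hmon : q.Monic) (hdeg : q.natDegree = m)
    {r : ℝ} {g : ℝ[X]} (hg : q = (X - C r) * g) :
    (1 - r ^ 2) * g.eval r * jacobiFunctional hα hβ g
      = (2 * m + α + β + 1) * jacobiFunctional hα hβ (q * q) := by
  have hgmon : g.Monic := (monic_X_sub_C r).of_mul_monic_left (hg ▸ hmon)
  have hgdeg : g.natDegree + 1 = m := by
    rw [← hdeg, hg, natDegree_mul (X_sub_C_ne_zero r) hgmon.ne_zero, natDegree_X_sub_C, add_comm]
  obtain ⟨k, rfl⟩ : ∃ k, m = k + 1 := ⟨_, hgdeg.symm⟩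
  have hgk : g.natDegree = k := by omega
  have hq1 : q.coeff (k + 1) = 1 := by rw [← hdeg]; exact hmon
  have hg1 : g.coeff k = 1 := by rw [← hgk]; exact hgmon
  have hq0 : ∀ N, k + 1 < N → q.coeff N = 0 :=
    fun N hN => coeff_eq_zero_of_natDegree_lt (hdeg.trans_lt hN)
  have hg0 : ∀ N, k < N → g.coeff N = 0 :=
    fun N hN => coeff_eq_zero_of_natDegree_lt (hgk.trans_lt hN)
  have hder : Polynomial.derivative q = g + (X - C r) * Polynomial.derivative g := by
    rw [hg, derivative_mul, derivative_X_sub_C, one_mul]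
  have hroot : ((1 - X ^ 2) * Polynomial.derivative q - C ((1 - r ^ 2) * g.eval r)).IsRoot r := by
    rw [hder]
    simp
  obtain ⟨s, hs⟩ := dvd_iff_isRoot.mpr hroot
  have hcs : ∀ N, k + 1 ≤ N → s.coeff N - r * s.coeff (N + 1) = -N * q.coeff N := by
    intro N hN
    have hc := congrArg (fun p => p.coeff (N + 1)) hs
    simp only [sub_mul, coeff_sub, one_mul, coeff_C_succ, coeff_X_mul, coeff_C_mul] at hc
    rw [pow_two, mul_assoc, coeff_X_mul, coeff_X_mul_derivative, coeff_derivative,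
      hq0 (N + 1 + 1) (by omega)] at hc
    linarith
  have hsdeg : s.natDegree ≤ k + 1 := by
    rcases eq_or_ne s 0 with rfl | hs0
    · simp
    by_contra! hlt
    have := hcs s.natDegree hlt.le
    rw [coeff_eq_zero_of_natDegree_lt (Nat.lt_succ_self _), hq0 _ hlt] at this
    exact leadingCoeff_ne_zero.mpr hs0 (by rw [leadingCoeff]; linarith)
  have hs1 : s.coeff (k + 1) = -(k + 1) := by
    have := hcs (k + 1) le_rfl
    rw [coeff_eq_zero_of_natDegree_lt (Nat.lt_succ_of_le hsdeg), hq1] at this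
    push_cast at this
    linarith
  -- Chosen so that `(1-r²) g(r) g` is the Pearson expression of `q g` minus `q u`. Hence only the
  -- coefficient of `X^m` in `u`, namely `-(2m+α+β+1)`, contributes.
  set u : ℝ[X] := jacobiDrift α β * g + (1 - X ^ 2) * Polynomial.derivative g + s with hu
  have hcu : ∀ N, k ≤ N → u.coeff (N + 1)
      = -(α + β + 2) * g.coeff N - N * g.coeff N + s.coeff (N + 1) := by
    intro N hN
    rw [hu, jacobiDrift, sub_mul, sub_mul, mul_assoc, pow_two, mul_assoc, one_mul]
    simp only [coeff_add, coeff_sub, coeff_C_mul, coeff_X_mul]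
    rw [coeff_X_mul_derivative, coeff_derivative, hg0 (N + 1) (by omega),
      hg0 (N + 1 + 1) (by omega)]
    ring
  have hudeg : u.natDegree ≤ k + 1 := by
    rw [natDegree_le_iff_coeff_eq_zero]
    intro N hN
    obtain ⟨M, rfl⟩ : ∃ M, N = M + 1 := ⟨N - 1, by omega⟩
    rw [hcu M (by omega), hg0 M (by omega), coeff_eq_zero_of_natDegree_lt (hsdeg.trans_lt hN)]
    ring
  have hmain := h.functional_mul hα hβ hmon hdeg hudeg
  rw [hcu k le_rfl, hg1, hs1] at hmain
  have hP := jacobiFunctional_pearson hα hβ (q * g)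
  rw [← jacobiFunctional_C_mul, show C ((1 - r ^ 2) * g.eval r) * g
      = jacobiDrift α β * (q * g) + (1 - X ^ 2) * Polynomial.derivative (q * g) - q * u by
    rw [hu, derivative_mul]
    linear_combination -g * hs + s * hg, map_sub, hP, hmain]
  push_cast
  ring

/-- Coefficient bounds for a quotient `s` of a linear perturbation of `q` by `1 ∓ X`. -/
theorem coeff_and_natDegree_of_endpoint {m : ℕ} {q s : ℝ[X]} (hmon : q.Monic)
    (hdeg : q.natDegree = m) {ε c : ℝ} (hε : ε ^ 2 = 1)
    (hs : C c = (1 + C ε * X) * q + (1 - C ε * X) * s) :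
    s.natDegree ≤ m ∧ s.coeff m = 1 := by
  have hε0 : ε ≠ 0 := by rintro rfl; norm_num at hε
  -- Comparison of the coefficients of `X^(N+1)`. For `N = deg s > m` it would make the leading
  -- coefficient of `s` vanish; for `N = m` it gives the value 1.
  have hcs : ∀ N, m ≤ N → s.coeff (N + 1) - ε * s.coeff N = -ε * q.coeff N := by
    intro N hN
    have hc := congrArg (fun p => p.coeff (N + 1)) hs
    simp only [add_mul, sub_mul, mul_assoc, coeff_sub, coeff_add, one_mul, coeff_C_succ,
      coeff_X_mul, coeff_C_mul] at hc
    rw [coeff_eq_zero_of_natDegree_lt (show q.natDegree < N + 1 by omega)] at hc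
    linarith
  have hsdeg : s.natDegree ≤ m := by
    rcases eq_or_ne s 0 with rfl | hs0
    · simp
    by_contra! hlt
    have := hcs s.natDegree hlt.le
    rw [coeff_eq_zero_of_natDegree_lt (Nat.lt_succ_self _),
      coeff_eq_zero_of_natDegree_lt (hdeg.trans_lt hlt)] at this
    exact leadingCoeff_ne_zero.mpr hs0
      (mul_left_cancel₀ hε0 (by rw [leadingCoeff]; linarith))
  refine ⟨hsdeg, ?_⟩
  have hq1 : q.coeff m = 1 := by rw [← hdeg]; exact hmon
  have := hcs m le_rfl
  rw [coeff_eq_zero_of_natDegree_lt (Nat.lt_succ_of_le hsdeg), hq1] at this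
  exact mul_left_cancel₀ hε0 (by linarith)

/-- This is the cofactor of `q` in the endpoint computations, with `ε = 1` at the right end and `ε =
-1` at the left. -/
theorem natDegree_one_add_X_mul_derivative_add {m : ℕ} {q s : ℝ[X]} (hmon : q.Monic)
    (hdeg : q.natDegree = m) (hsdeg : s.natDegree ≤ m) (hs1 : s.coeff m = 1) (ε a b : ℝ) :
    (C a * q + 2 * (C ε + X) * derivative q + C b * s).natDegree ≤ m ∧
      (C a * q + 2 * (C ε + X) * derivative q + C b * s).coeff m = a + 2 * m + b := by
  have hcu : ∀ N, m ≤ N → (C a * q + 2 * (C ε + X) * derivative q + C b * s).coeff N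
      = a * q.coeff N + 2 * N * q.coeff N + b * s.coeff N := by
    intro N hN
    rw [show C a * q + 2 * (C ε + X) * derivative q + C b * s
      = C a * q + C 2 * (C ε * derivative q + X * derivative q) + C b * s by
        rw [show (C 2 : ℝ[X]) = 2 from rfl]; ring]
    simp only [coeff_add, coeff_C_mul, coeff_X_mul_derivative, coeff_derivative]
    rw [coeff_eq_zero_of_natDegree_lt (show q.natDegree < N + 1 by omega)]
    ring
  constructor
  · rw [natDegree_le_iff_coeff_eq_zero]
    intro N hN
    rw [hcu N hN.le, coeff_eq_zero_of_natDegree_lt (hdeg.trans_lt hN),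
      coeff_eq_zero_of_natDegree_lt (hsdeg.trans_lt hN)]
    ring
  · have hq1 : q.coeff m = 1 := by rw [← hdeg]; exact hmon
    rw [hcu m le_rfl, hq1, hs1]
    ring

/-- The linear coefficient equals `(β+1)(1-X) - (α+1)(1+X)`. In the Pearson identity for `(1+X) q²`
everything except `-(α+1)(1+X)² q²` is divisible by `1-X²`. Replacing one factor `(1+X) q` of that
term by its value at 1 plus a multiple of `1-X` leaves `L'(q u)` with `deg u ≤ m`. -/
theorem IsJacobiSolution.functional_right_endpoint {m : ℕ} {α β : ℝ} (hα : -1 < α) (hβ : -1 < β)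
    (hα' : -1 < α + 1) (hβ' : -1 < β + 1) {q : ℝ[X]} (h : IsJacobiSolution m (α + 1) (β + 1) q)
    (hmon : q.Monic) (hdeg : q.natDegree = m) :
    (α + 1) * (2 * q.eval 1 * jacobiFunctional hα hβ ((X + 1) * q))
      = (2 * m + α + β + 3) * jacobiFunctional hα' hβ' (q * q) := by
  have hroot : (C (2 * q.eval 1) - (1 + X) * q).IsRoot 1 := by
    simp
    ring
  obtain ⟨s, hs⟩ := dvd_iff_isRoot.mpr hroot
  rw [C_1] at hs
  obtain ⟨hsdeg, hs1⟩ := coeff_and_natDegree_of_endpoint (s := -s) (c := 2 * q.eval 1) hmon hdeg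
    (ε := 1) (by norm_num) (by rw [C_1]; linear_combination hs)
  obtain ⟨hudeg, hu1⟩ := natDegree_one_add_X_mul_derivative_add hmon hdeg hsdeg hs1
    1 (β + 2) (α + 1)
  have hmain := h.functional_mul hα' hβ' hmon hdeg hudeg
  rw [hu1, jacobiFunctional_succ hα hβ] at hmain
  have hP := jacobiFunctional_pearson hα hβ ((1 + X) * q * q)
  rw [← jacobiFunctional_C_mul, ← jacobiFunctional_C_mul,
    show (2 * (m : ℝ) + α + β + 3) = β + 2 + 2 * m + (α + 1) by ring, ← hmain, ← sub_eq_zero,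
    ← map_sub, ← neg_eq_zero, ← map_neg, ← hP]
  congr 1
  simp only [jacobiDrift, derivative_mul, derivative_one, derivative_X, map_add, map_sub,
    map_mul, map_one, map_ofNat] at hs ⊢
  linear_combination (-(C α + 1) * (1 + X) * q) * hs

theorem IsJacobiSolution.functional_left_endpoint {m : ℕ} {α β : ℝ} (hα : -1 < α) (hβ : -1 < β)
    (hα' : -1 < α + 1) (hβ' : -1 < β + 1) {q : ℝ[X]} (h : IsJacobiSolution m (α + 1) (β + 1) q)
    (hmon : q.Monic) (hdeg : q.natDegree = m) :
    (β + 1) * (-2 * q.eval (-1) * jacobiFunctional hα hβ ((X - 1) * q))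
      = (2 * m + α + β + 3) * jacobiFunctional hα' hβ' (q * q) := by
  have hroot : (C (2 * q.eval (-1)) - (1 - X) * q).IsRoot (-1) := by
    simp
    ring
  obtain ⟨s, hs⟩ := dvd_iff_isRoot.mpr hroot
  rw [C_neg, C_1] at hs
  obtain ⟨hsdeg, hs1⟩ := coeff_and_natDegree_of_endpoint (s := s) (c := 2 * q.eval (-1)) hmon hdeg
    (ε := -1) (by norm_num) (by rw [C_neg, C_1]; linear_combination hs)
  obtain ⟨hudeg, hu1⟩ := natDegree_one_add_X_mul_derivative_add hmon hdeg hsdeg hs1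
    (-1) (α + 2) (β + 1)
  have hmain := h.functional_mul hα' hβ' hmon hdeg hudeg
  rw [hu1, jacobiFunctional_succ hα hβ] at hmain
  have hP := jacobiFunctional_pearson hα hβ ((1 - X) * q * q)
  rw [← jacobiFunctional_C_mul, ← jacobiFunctional_C_mul,
    show (2 * (m : ℝ) + α + β + 3) = α + 2 + 2 * m + (β + 1) by ring, ← hmain, ← sub_eq_zero,
    ← map_sub, ← hP]
  congr 1
  simp only [jacobiDrift, derivative_mul, derivative_one, derivative_X, map_add, map_sub,
    map_mul, map_one, map_ofNat, map_neg] at hs ⊢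
  linear_combination ((C β + 1) * (1 - X) * q) * hs

/-! ### Barycentric weights, quadrature weights and the constant -/

theorem barycentricWeight_eq {n : ℕ} (x : Fin (n + 1) → ℝ) (j : Fin (n + 1)) :
    barycentricWeight x j = ((Lagrange.nodal (Finset.univ.erase j) x).eval (x j))⁻¹ := by
  rw [barycentricWeight, Lagrange.eval_nodal, one_div]

theorem jacobiQuadWeight_eq {n : ℕ} {α β : ℝ} (hα : -1 < α) (hβ : -1 < β)
    (x : Fin (n + 1) → ℝ) (j : Fin (n + 1)) :
    jacobiQuadWeight α β x j = barycentricWeight x j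
      * jacobiFunctional hα hβ (Lagrange.nodal (Finset.univ.erase j) x) := by
  have hbasis : Lagrange.basis Finset.univ x j
      = C (barycentricWeight x j) * Lagrange.nodal (Finset.univ.erase j) x := by
    simp only [Lagrange.basis, Lagrange.basisDivisor, Lagrange.nodal_eq, Finset.prod_mul_distrib,
      barycentricWeight, one_div, ← Finset.prod_inv_distrib, map_prod]
  rw [← jacobiFunctional_C_mul, ← hbasis, jacobiFunctional_apply, jacobiQuadWeight]

/-- Exactly the `n - j` factors with `k > j` are negative. -/
theorem barycentricWeight_sign {n : ℕ} {x : Fin (n + 1) → ℝ} (hx : StrictMono x)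
    (j : Fin (n + 1)) : 0 < (-1) ^ n * (-1) ^ (j : ℕ) * barycentricWeight x j := by
  have hsplit : Finset.univ.erase j = Finset.Iio j ∪ Finset.Ioi j := by
    ext k
    simp
  have hdisj : Disjoint (Finset.Iio j) (Finset.Ioi j) := by
    rw [Finset.disjoint_left]
    intro k h1 h2
    exact lt_asymm (Finset.mem_Iio.mp h1) (Finset.mem_Ioi.mp h2)
  have hneg : ∏ k ∈ Finset.Ioi j, (x j - x k)
      = (-1) ^ (n - j : ℕ) * ∏ k ∈ Finset.Ioi j, (x k - x j) := by
    have hcard : n - (j : ℕ) = (Finset.Ioi j).card := by simp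
    rw [hcard, ← Finset.prod_const, ← Finset.prod_mul_distrib]
    exact Finset.prod_congr rfl fun k _ => by ring
  have hpow : ((-1 : ℝ) ^ n * (-1) ^ (j : ℕ)) = (-1) ^ (n - j : ℕ) := by
    have hj : (j : ℕ) ≤ n := Nat.lt_succ_iff.mp j.is_lt
    have hadd := pow_add (-1 : ℝ) (n - j : ℕ) j
    rw [Nat.sub_add_cancel hj] at hadd
    rw [hadd, mul_assoc, ← mul_pow]
    norm_num
  have h1 : 0 < ∏ k ∈ Finset.Iio j, (x j - x k) :=
    Finset.prod_pos fun k hk => sub_pos.mpr (hx (Finset.mem_Iio.mp hk))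
  have h2 : 0 < ∏ k ∈ Finset.Ioi j, (x k - x j) :=
    Finset.prod_pos fun k hk => sub_pos.mpr (hx (Finset.mem_Ioi.mp hk))
  rw [barycentricWeight, hsplit, Finset.prod_union hdisj, hneg, hpow]
  rcases neg_one_pow_eq_or ℝ (n - j : ℕ) with h | h <;> rw [h]
  · rw [one_mul, one_mul]
    positivity
  · rw [show (-1) * (1 / ((∏ k ∈ Finset.Iio j, (x j - x k))
        * ((-1) * ∏ k ∈ Finset.Ioi j, (x k - x j))))
      = 1 / ((∏ k ∈ Finset.Iio j, (x j - x k)) * ∏ k ∈ Finset.Ioi j, (x k - x j)) by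
        field_simp]
    positivity

theorem IsJacobiLobattoNodes.lobattoDelta_mul_functional_nodal {m : ℕ} {α β : ℝ} (hα : -1 < α)
    (hβ : -1 < β) (hα' : -1 < α + 1) (hβ' : -1 < β + 1) {x : Fin (m + 1 + 1) → ℝ}
    (hx : IsJacobiLobattoNodes (m + 1) α β x) {q : ℝ[X]}
    (h : IsJacobiSolution m (α + 1) (β + 1) q) (hq : q.Monic) (hdeg : q.natDegree = m)
    {c : ℝ} (hc : c ≠ 0) (hder : derivative (jacobiPoly (m + 1) α β) = C c * q)
    (j : Fin (m + 1 + 1)) :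
    lobattoDelta α β j * ((Lagrange.nodal (Finset.univ.erase j) x).eval (x j)
      * jacobiFunctional hα hβ (Lagrange.nodal (Finset.univ.erase j) x))
      = (2 * m + α + β + 3) * jacobiFunctional hα' hβ' (q * q) := by
  have hG := hx.nodal_eq hq hdeg hc hder
  rw [Lagrange.nodal_eq_mul_nodal_erase (Finset.mem_univ j)] at hG
  set G := Lagrange.nodal (Finset.univ.erase j) x
  -- Identifies `G` by cancelling `X - x_j`: it is `(X-1) q`, `(X+1) q` or `(X²-1) g` according to
  -- the position of the node.
  have hcancel : ∀ p : ℝ[X], (X - C (x j)) * p = (X ^ 2 - 1) * q → G = p := fun p hp =>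
    mul_left_cancel₀ (X_sub_C_ne_zero (x j)) (hG.trans hp.symm)
  rcases eq_or_ne j 0 with rfl | hj0
  · rw [hcancel ((X - 1) * q) (by rw [hx.first, C_neg, C_1]; ring), hx.first, lobattoDelta,
      if_pos rfl, ← h.functional_left_endpoint hα hβ hα' hβ' hq hdeg]
    simp only [eval_mul, eval_sub, eval_X, eval_one]
    ring
  rcases eq_or_ne j (Fin.last (m + 1)) with rfl | hjl
  · rw [hcancel ((X + 1) * q) (by rw [hx.last, C_1]; ring), hx.last, lobattoDelta,
      if_neg hj0, if_pos rfl, ← h.functional_right_endpoint hα hβ hα' hβ' hq hdeg]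
    simp only [eval_mul, eval_add, eval_X, eval_one]
    ring
  have h1 : x j - 1 ≠ 0 := by
    rw [sub_ne_zero, ← hx.last]
    exact hx.strictMono.injective.ne hjl
  have h2 : x j + 1 ≠ 0 := by
    rw [← sub_neg_eq_add, sub_ne_zero, ← hx.first]
    exact hx.strictMono.injective.ne hj0
  have hroot : q.IsRoot (x j) := by
    have := congrArg (eval (x j)) hG
    simp only [eval_mul, eval_sub, eval_X, eval_C, eval_pow, eval_one, sub_self, zero_mul] at this
    refine (mul_eq_zero.mp this.symm).resolve_left ?_
    rw [show x j ^ 2 - 1 = (x j - 1) * (x j + 1) by ring]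
    exact mul_ne_zero h1 h2
  obtain ⟨g, hg⟩ := dvd_iff_isRoot.mpr hroot
  have hmain := h.functional_div_root hα' hβ' hq hdeg hg
  rw [jacobiFunctional_succ hα hβ] at hmain
  rw [hcancel ((X ^ 2 - 1) * g) (by rw [hg]; ring), lobattoDelta, if_neg hj0, if_neg hjl,
    show (2 * (m : ℝ) + α + β + 3) = 2 * m + (α + 1) + (β + 1) + 1 by ring, ← hmain,
    show (X ^ 2 - 1) * g = -((1 - X ^ 2) * g) by ring, map_neg]
  simp only [eval_neg, eval_mul, eval_sub, eval_one, eval_pow, eval_X]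
  ring

theorem jacobiBaryConst_eq (m : ℕ) {α β : ℝ} (hα : -1 < α) (hβ : -1 < β) (hα' : -1 < α + 1)
    (hβ' : -1 < β + 1) {q : ℝ[X]} (h : IsJacobiSolution m (α + 1) (β + 1) q) (hq : q.Monic)
    (hdeg : q.natDegree = m) :
    jacobiBaryConst (((m + 1 : ℕ) : ℤ) - 2) (α + 1) (β + 1)
      = (-1) ^ (m + 1) / √((2 * m + α + β + 3) * jacobiFunctional hα' hβ' (q * q)) := by
  have hm : (0 : ℝ) ≤ m := m.cast_nonneg
  have hsign : (if Even (((m + 1 : ℕ) : ℤ) - 2) then (1 : ℝ) else -1) = (-1) ^ (m + 1) := by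
    have : Even (((m + 1 : ℕ) : ℤ) - 2) ↔ Even (m + 1) := by
      rw [Int.even_sub, Int.even_coe_nat]
      simp
    rcases Nat.even_or_odd (m + 1) with he | ho
    · rw [if_pos (this.mpr he), he.neg_one_pow]
    · rw [if_neg (fun he => Nat.not_even_iff_odd.mpr ho (this.mp he)), ho.neg_one_pow]
  have hidx : ((((m + 1 : ℕ) : ℤ) - 2 : ℤ) : ℝ) = m - 1 := by push_cast; ring
  -- The index of the constant is `n - 2 = m - 1`, so its factorial is `m!`, also for `n = 1`, where
  -- the index is `-1`.
  have hnat : ((((m + 1 : ℕ) : ℤ) - 2) + 1).toNat = m := by omega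
  have hG := Real.Gamma_pos_of_pos (show 0 < 2 * (m : ℝ) + α + β + 3 by linarith)
  set N : ℝ := (m.factorial : ℝ) * Real.Gamma (m + α + β + 3) * Real.Gamma (m + α + 2)
    * Real.Gamma (m + β + 2) with hN
  have hNpos : 0 < N := by
    have g1 := Real.Gamma_pos_of_pos (show 0 < (m : ℝ) + α + β + 3 by linarith)
    have g2 := Real.Gamma_pos_of_pos (show 0 < (m : ℝ) + α + 2 by linarith)
    have g3 := Real.Gamma_pos_of_pos (show 0 < (m : ℝ) + β + 2 by linarith)
    positivity
  -- The factor `2m+α+β+3` turns `Γ(2m+α+β+4)` in the denominator into `Γ(2m+α+β+3)`, which makes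
  -- the Gamma denominator a square.
  have hK : (2 * m + α + β + 3) * jacobiFunctional hα' hβ' (q * q)
      = (2 ^ ((m : ℝ) + (α + β + 3) / 2) * √N / Real.Gamma (2 * m + α + β + 3)) ^ 2 := by
    have hne : 2 * (m : ℝ) + α + β + 3 ≠ 0 := by linarith
    rw [h.functional_sq m hα' hβ' (by linarith) hq hdeg, div_pow, mul_pow,
      Real.sq_sqrt hNpos.le, ← Real.rpow_natCast (2 ^ _) 2, ← Real.rpow_mul two_pos.le,
      show 2 * (m : ℝ) + (α + 1) + (β + 1) + 2 = 2 * m + α + β + 3 + 1 by ring,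
      show 2 * (m : ℝ) + (α + 1) + (β + 1) + 1 = 2 * m + α + β + 3 by ring,
      Real.Gamma_add_one hne,
      show ((m : ℝ) + (α + β + 3) / 2) * (2 : ℕ) = 2 * m + α + β + 3 by push_cast; ring, hN,
      show (m : ℝ) + (α + 1) + 1 = m + α + 2 by ring,
      show (m : ℝ) + (β + 1) + 1 = m + β + 2 by ring,
      show (m : ℝ) + (α + 1) + (β + 1) + 1 = m + α + β + 3 by ring]
    field_simp
  have hs := Real.sqrt_pos.mpr hNpos
  have h2 : (0 : ℝ) < 2 ^ ((m : ℝ) + (α + β + 3) / 2) := by positivity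
  rw [hK, Real.sqrt_sq (by positivity), jacobiBaryConst, hsign, hidx, hnat,
    show 2 * ((m : ℝ) - 1) + (α + 1) + (β + 1) + 3 = 2 * m + α + β + 3 by ring,
    show (m : ℝ) - 1 + 1 + ((α + 1) + (β + 1) + 1) / 2 = m + (α + β + 3) / 2 by ring,
    show (m : ℝ) - 1 + (α + 1) + (β + 1) + 2 = m + α + β + 3 by ring,
    show (m : ℝ) - 1 + (α + 1) + 2 = m + α + 2 by ring,
    show (m : ℝ) - 1 + (β + 1) + 2 = m + β + 2 by ring, ← hN]
  field_simp

theorem IsJacobiLobattoNodes.barycentricWeight_eq_mul_sqrt {n : ℕ} (hn : 1 ≤ n) {α β : ℝ}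
    (hα : -1 < α) (hβ : -1 < β) {x : Fin (n + 1) → ℝ} (hx : IsJacobiLobattoNodes n α β x) :
    jacobiBaryConst ((n : ℤ) - 2) (α + 1) (β + 1) ≠ 0 ∧ ∀ j : Fin (n + 1),
      barycentricWeight x j = jacobiBaryConst ((n : ℤ) - 2) (α + 1) (β + 1) * (-1) ^ (j : ℕ)
        * √(lobattoDelta α β j * jacobiQuadWeight α β x j) := by
  obtain ⟨m, rfl⟩ := Nat.exists_eq_add_of_le' hn
  have hα' : -1 < α + 1 := by linarith
  have hβ' : -1 < β + 1 := by linarith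
  have hm : (0 : ℝ) ≤ m := m.cast_nonneg
  obtain ⟨q, h, hq, hdeg, c, hc, hder⟩ := exists_monic_jacobiPoly_derivative m hα hβ
  rw [jacobiBaryConst_eq m hα hβ hα' hβ' h hq hdeg]
  have hpos : 0 < (2 * m + α + β + 3) * jacobiFunctional hα' hβ' (q * q) :=
    mul_pos (by linarith) (jacobiFunctional_pos hα' hβ' (mul_ne_zero hq.ne_zero hq.ne_zero)
      fun t _ => by rw [eval_mul]; exact mul_self_nonneg _)
  have hK := hx.lobattoDelta_mul_functional_nodal hα hβ hα' hβ' h hq hdeg hc hder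
  set K := (2 * m + α + β + 3) * jacobiFunctional hα' hβ' (q * q)
  have hsK := Real.sqrt_pos.mpr hpos
  refine ⟨div_ne_zero (pow_ne_zero _ (by norm_num)) hsK.ne', fun j => ?_⟩
  have hsgn := barycentricWeight_sign hx.strictMono j
  have hne : barycentricWeight x j ≠ 0 := right_ne_zero_of_mul hsgn.ne'
  -- The signs are inert inside the square, but they make its base positive, so that the square root
  -- can be taken directly.
  have hw : lobattoDelta α β j * jacobiQuadWeight α β x j
      = K * ((-1) ^ (m + 1) * (-1) ^ (j : ℕ) * barycentricWeight x j) ^ 2 := by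
    have hval : (Lagrange.nodal (Finset.univ.erase j) x).eval (x j)
        = (barycentricWeight x j)⁻¹ := by rw [barycentricWeight_eq, inv_inv]
    rw [← hK j, hval, jacobiQuadWeight_eq hα hβ, mul_pow, mul_pow, ← pow_mul, ← pow_mul,
      mul_comm (m + 1) 2, mul_comm (j : ℕ) 2, pow_mul, pow_mul]
    field_simp
    norm_num
  rw [hw, Real.sqrt_mul hpos.le, Real.sqrt_sq hsgn.le]
  have e1 : ((-1 : ℝ) ^ (m + 1)) * (-1) ^ (m + 1) = 1 := by rw [← mul_pow]; norm_num
  have e2 : ((-1 : ℝ) ^ (j : ℕ)) * (-1) ^ (j : ℕ) = 1 := by rw [← mul_pow]; norm_num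
  field_simp
  linear_combination -((-1) ^ (j : ℕ)) ^ 2 * e1 - e2

theorem corollary3p3 (n : ℕ) (hn : 1 ≤ n) (α β : ℝ) (hα : -1 < α) (hβ : -1 < β) :
    (∃ x : Fin (n + 1) → ℝ, IsJacobiLobattoNodes n α β x) ∧
    ∀ x : Fin (n + 1) → ℝ, IsJacobiLobattoNodes n α β x →
      (∀ j : Fin (n + 1),
        barycentricWeight x j =
          jacobiBaryConst ((n : ℤ) - 2) (α + 1) (β + 1) * (-1) ^ (j : ℕ)
            * √(lobattoDelta α β j * jacobiQuadWeight α β x j)) ∧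
      IsSimplifiedBarycentricWeights x
        (fun j => (-1) ^ (j : ℕ) * √(lobattoDelta α β j * jacobiQuadWeight α β x j)) := by
  refine ⟨exists_isJacobiLobattoNodes hn hα hβ, fun x hx => ?_⟩
  obtain ⟨hne, heq⟩ := hx.barycentricWeight_eq_mul_sqrt hn hα hβ
  exact ⟨heq, _, hne, fun j => by rw [heq j, mul_assoc]⟩
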